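/- For a simple graph $G$ on finitely many vertices, let $\mathcal S(G)$ be the set of real symmetric matrices $A$, with rows and columns indexed by the vertices of $G$, such that for all distinct vertices $i,j$ one has $A_{ij}\neq 0$ if and only if $i$ and $j$ are adjacent (the diagonal entries are arbitrary). Let $q(G)$ be the minimum, over all $A\in\mathcal S(G)$, of the number of distinct eigenvalues of $A$. If $G$ has $N$ vertices and $q(G)=2$, let $MB(G)$ be the least integer $k$ with $1\le k\leq\lfloor N/2\rfloor$ for which some $A\in\mathcal S(G)$ has exactly two distinct eigenvalues, of multiplicities $N-k$ and $k$. Let $G\vee H$ denote the join of $G$ and $H$ (the disjoint union of $G$ and $H$ together with all edges between a vertex of $G$ and a vertex of $H$), and let $\overline{K_n}$ be the graph on $n$ vertices with no edges. **Lemma.** Let $G$ be a connected simple graph on $n\geq 2$ vertices. Then $q(G\vee\overline{K_n})=2$ and $MB(G\vee\overline{K_n})=n$. -/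

import Mathlib

namespace SimpleGraph

/-- The join `G ∨ H`: the disjoint union of `G` and `H` together with all edges between
a vertex of `G` and a vertex of `H`. -/
def join {V W : Type*} (G : SimpleGraph V) (H : SimpleGraph W) : SimpleGraph (V ⊕ W) :=
  (G ⊕g H) ⊔ completeBipartiteGraph V W

/-- `𝒮(G)`: the real symmetric matrices indexed by the vertices of `G` whose off-diagonal entries
are nonzero precisely at adjacent pairs; the diagonal entries are free. -/
def symmMatrices {V : Type*} (G : SimpleGraph V) : Set (Matrix V V ℝ) :=
  {A | A.IsSymm ∧ ∀ i j, i ≠ j → (A i j ≠ 0 ↔ G.Adj i j)}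

end SimpleGraph

/-- `q(A)`: the number of distinct (real) eigenvalues of a matrix. -/
noncomputable def Matrix.numDistinctEigenvalues {V : Type*} [Fintype V] [DecidableEq V]
    (A : Matrix V V ℝ) : ℕ :=
  (spectrum ℝ A).ncard

/-- The multiset of the multiplicities of the distinct (real) eigenvalues of a matrix. -/
noncomputable def Matrix.eigenvalueMultiplicities {V : Type*} [Fintype V] [DecidableEq V]
    (A : Matrix V V ℝ) : Multiset ℕ :=
  A.charpoly.roots.dedup.map fun μ => A.charpoly.roots.count μ

namespace SimpleGraph

/-- `q(G)`: the minimum number of distinct eigenvalues of a matrix in `𝒮(G)`. -/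
noncomputable def minDistinctEigenvalues {V : Type*} [Fintype V] [DecidableEq V]
    (G : SimpleGraph V) : ℕ :=
  sInf {m | ∃ A ∈ G.symmMatrices, A.numDistinctEigenvalues = m}

/-- `G ∈ MP(p)`: the multiplicity partition `p` is achievable by `G`, that is, some matrix in
`𝒮(G)` has `p` as the multiset of multiplicities of its distinct eigenvalues. -/
def AchievesMultiplicityPartition {V : Type*} [Fintype V] [DecidableEq V]
    (G : SimpleGraph V) (p : Multiset ℕ) : Prop :=
  ∃ A ∈ G.symmMatrices, A.eigenvalueMultiplicities = p

/-- `MB(G)`: for a graph on `N` vertices, the least `k ≤ ⌊N / 2⌋` such that `G` achieves the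
multiplicity bipartition `[N - k, k]`. Such a `k` is automatically positive, since multiplicities
are; so the value is `0` exactly when no multiplicity bipartition is achieved, that is, when `MB(G)`
is undefined. -/
noncomputable def minMultiplicityBipartition {V : Type*} [Fintype V] [DecidableEq V]
    (G : SimpleGraph V) : ℕ :=
  sInf {k | k ≤ Fintype.card V / 2 ∧ G.AchievesMultiplicityPartition {Fintype.card V - k, k}}

end SimpleGraph

/-! Upper bound: an orthogonal projection `Z * Zᵀ` of rank `n` represents the join. Here `Z` stacks
a square block `U` over a diagonal block `D`: `U * Uᵀ` represents `G`, `D * Dᵀ` is diagonal, and `U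
* D` has no zero entry. Scaling an orthonormal eigenbasis of some `M ∈ 𝒮(G)` yields `U`, provided no
eigenvector of `M` has a zero entry. Such an `M` is a small perturbation of a spanning tree matrix
with widely spread diagonal.

Lower bound: if `A` has only the eigenvalues `a` and `b`, then `A - a` is a multiple of a
projection. On the `n` independent vertices its principal submatrix is diagonal with nonzero
entries, so its rank is at least `n` (`card_le_card_ne_of_independent`). -/

open scoped Matrix

/-! ### Tree matrices whose eigenvectors have no zero entry -/

/-- In a tree, a vertex has at most one neighbour closer to a given root. -/
lemma SimpleGraph.IsTree.eq_of_adj_of_dist_add_one {V : Type*} {T : SimpleGraph V} (hT : T.IsTree)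
    {r u w w' : V} (hw : T.Adj w u) (hw' : T.Adj w' u)
    (hd : T.dist r u = T.dist r w + 1) (hd' : T.dist r u = T.dist r w' + 1) : w = w' := by
  obtain ⟨p, hp⟩ := hT.connected.exists_walk_length_eq_dist r w
  obtain ⟨q, hq⟩ := hT.connected.exists_walk_length_eq_dist r w'
  have h1 : (p.concat hw).IsPath :=
    SimpleGraph.Walk.isPath_of_length_eq_dist _ (by simp [hp, hd])
  have h2 : (q.concat hw').IsPath :=
    SimpleGraph.Walk.isPath_of_length_eq_dist _ (by simp [hq, hd'])
  exact (SimpleGraph.Walk.concat_inj ((hT.existsUnique_path r u).unique h1 h2)).1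

/-- In a connected graph, every vertex other than the root has a neighbour closer to the root. -/
lemma SimpleGraph.Connected.exists_adj_dist_add_one {V : Type*} {G : SimpleGraph V}
    (hG : G.Connected) {r u : V} (hu : u ≠ r) :
    ∃ w, G.Adj w u ∧ G.dist r u = G.dist r w + 1 := by
  obtain ⟨p, hp⟩ := hG.exists_walk_length_eq_dist u r
  cases p with
  | nil => exact absurd rfl hu
  | @cons _ w _ h q =>
    refine ⟨w, h.symm, ?_⟩
    have h1 := SimpleGraph.dist_le q
    have h2 := h.diff_dist_adj (u := r)
    rw [SimpleGraph.Walk.length_cons, SimpleGraph.dist_comm] at hp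
    rw [SimpleGraph.dist_comm] at h1
    omega

/-- No eigenvector of the matrix has a zero entry. -/
def Matrix.EigenvectorsNowhereZero {V : Type*} [Fintype V] (M : Matrix V V ℝ) : Prop :=
  ∀ (c : ℝ) (v : V → ℝ), M *ᵥ v = c • v → (∃ i, v i = 0) → v = 0

section Tree

variable {V : Type*} [Fintype V] {T : SimpleGraph V} [DecidableRel T.Adj]
  {r : V} {e v : V → ℝ}

/-- A function on a tree satisfying an eigenvalue equation with large diagonal away from the root
does not increase away from the root. -/
lemma SimpleGraph.IsTree.abs_le_abs_of_dist (hT : T.IsTree)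
    (he : ∀ u, u ≠ r → (Fintype.card V : ℝ) ≤ |e u|)
    (hv : ∀ u, e u * v u = ∑ w ∈ T.neighborFinset u, v w) {u p : V} (hp : T.Adj p u)
    (hd : T.dist r u = T.dist r p + 1) : |v u| ≤ |v p| := by
  classical
  -- The induction runs from the deepest vertices towards the root.
  obtain ⟨B, hB⟩ := (Set.finite_range (T.dist r)).bddAbove
  replace hB : ∀ u, T.dist r u ≤ B := fun u => hB ⟨u, rfl⟩
  induction hm : B - T.dist r u using Nat.strong_induction_on generalizing u p with
  | _ m ih =>
  have hur : u ≠ r := by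
    rintro rfl
    simp at hd
  have hpm : p ∈ T.neighborFinset u := by simpa using hp.symm
  have hchild : ∀ w ∈ (T.neighborFinset u).erase p, |v w| ≤ |v u| := by
    intro w hw
    obtain ⟨hwp, hw⟩ := Finset.mem_erase.1 hw
    have hw : T.Adj u w := by simpa using hw
    rcases hT.dist_eq_dist_add_one_of_adj r hw with h | h
    · exact absurd (hT.eq_of_adj_of_dist_add_one hw.symm hp h hd) hwp
    · have := hB w
      exact ih (B - T.dist r w) (by omega) hw h rfl
  -- The children of `u` omit both `u` and `p`. With `c` children this leads to `(c + 2) |v u| ≤ |v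
  -- p| + c |v u|`.
  have hcard : ((T.neighborFinset u).erase p).card + 2 ≤ Fintype.card V := by
    rw [Finset.card_erase_of_mem hpm, SimpleGraph.card_neighborFinset_eq_degree]
    have h1 := T.degree_lt_card_verts u
    have h2 : 0 < T.degree u := (T.degree_pos_iff_exists_adj u).2 ⟨p, hp.symm⟩
    omega
  have hcard' : (((T.neighborFinset u).erase p).card : ℝ) + 2 ≤ Fintype.card V := by
    exact_mod_cast hcard
  have h1 : |e u| * |v u| ≤ |v p| + ((T.neighborFinset u).erase p).card * |v u| := by
    rw [← abs_mul, hv u, ← Finset.add_sum_erase _ _ hpm]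
    refine (abs_add_le _ _).trans (add_le_add le_rfl ?_)
    refine (Finset.abs_sum_le_sum_abs _ _).trans ((Finset.sum_le_sum hchild).trans ?_)
    simp
  have h2 := mul_le_mul_of_nonneg_right (hcard'.trans (he u hur)) (abs_nonneg (v u))
  nlinarith [abs_nonneg (v u)]

/-- A zero at `u` forces zeros at its children, so the equation at `u` makes the parent vanish too.
The zero thus climbs to the root, and monotonicity spreads it to the whole tree. -/
lemma SimpleGraph.IsTree.eq_zero_of_apply_eq_zero (hT : T.IsTree)
    (he : ∀ u, u ≠ r → (Fintype.card V : ℝ) ≤ |e u|)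
    (hv : ∀ u, e u * v u = ∑ w ∈ T.neighborFinset u, v w) {i : V} (hi : v i = 0) : v = 0 := by
  classical
  have up : ∀ m u, T.dist r u = m → v u = 0 → v r = 0 := by
    intro m
    induction m with
    | zero =>
      intro u hu h0
      rwa [(hT.connected.dist_eq_zero_iff).1 hu]
    | succ m ih =>
      intro u hu h0
      have hur : u ≠ r := by
        rintro rfl
        simp at hu
      obtain ⟨p, hp, hd⟩ := hT.connected.exists_adj_dist_add_one hur
      refine ih p (by omega) ?_
      have hpm : p ∈ T.neighborFinset u := by simpa using hp.symm
      have h := hv u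
      rw [← Finset.add_sum_erase _ _ hpm, Finset.sum_eq_zero, h0] at h
      · simpa using h.symm
      · intro w hw
        obtain ⟨hwp, hw⟩ := Finset.mem_erase.1 hw
        have hw : T.Adj u w := by simpa using hw
        rcases hT.dist_eq_dist_add_one_of_adj r hw with h | h
        · exact absurd (hT.eq_of_adj_of_dist_add_one hw.symm hp h hd) hwp
        · have := hT.abs_le_abs_of_dist he hv hw h
          rw [h0, abs_zero] at this
          exact abs_eq_zero.1 (le_antisymm this (abs_nonneg _))
  have hr := up _ i rfl hi
  have down : ∀ m u, T.dist r u = m → v u = 0 := by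
    intro m
    induction m with
    | zero =>
      intro u hu
      rwa [← (hT.connected.dist_eq_zero_iff).1 hu]
    | succ m ih =>
      intro u hu
      have hur : u ≠ r := by
        rintro rfl
        simp at hu
      obtain ⟨p, hp, hd⟩ := hT.connected.exists_adj_dist_add_one hur
      have := hT.abs_le_abs_of_dist he hv hp hd
      rw [ih p (by omega), abs_zero] at this
      exact abs_eq_zero.1 (le_antisymm this (abs_nonneg _))
  exact funext fun u => down _ u rfl

end Tree

/-- Some diagonal is spread out so much that every real number is far from all its entries but
one. -/
lemma exists_forall_exists_forall_ne_le_abs_sub (V : Type*) [Fintype V] [Nonempty V] (K : ℝ)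
    (hK : 0 ≤ K) :
    ∃ d : V → ℝ, ∀ c : ℝ, ∃ r, ∀ u, u ≠ r → K ≤ |c - d u| := by
  -- Entries are spaced `2 * K` apart and `r` is the nearest to `c`; another entry within less than
  -- `K` would put two entries less than `2 * K` apart.
  refine ⟨fun u => 2 * K * (Fintype.equivFin V u : ℕ), fun c => ?_⟩
  obtain ⟨r, hr⟩ := Finite.exists_min fun u => |c - 2 * K * (Fintype.equivFin V u : ℕ)|
  refine ⟨r, fun u hu => ?_⟩
  have h1 : (1 : ℝ) ≤ |((Fintype.equivFin V u : ℕ) : ℝ) - (Fintype.equivFin V r : ℕ)| := by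
    have : ((Fintype.equivFin V u : ℕ) : ℤ) - (Fintype.equivFin V r : ℕ) ≠ 0 := by
      intro h
      exact hu ((Fintype.equivFin V).injective (Fin.ext (by omega)))
    exact_mod_cast Int.one_le_abs this
  have h2 : 2 * K ≤ |(c - 2 * K * (Fintype.equivFin V r : ℕ))
      - (c - 2 * K * (Fintype.equivFin V u : ℕ))| := by
    rw [show (c - 2 * K * (Fintype.equivFin V r : ℕ)) - (c - 2 * K * (Fintype.equivFin V u : ℕ))
      = 2 * K * (((Fintype.equivFin V u : ℕ) : ℝ) - (Fintype.equivFin V r : ℕ)) by ring,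
      abs_mul, abs_of_nonneg (by positivity)]
    nlinarith
  have h3 := h2.trans (abs_sub _ _)
  have h4 := hr u
  simp only at h4 ⊢
  linarith

/-- The root varies with the eigenvalue `c`: it is the one vertex whose diagonal entry may be close
to `c`. -/
lemma SimpleGraph.IsTree.exists_diagonal_add_adjMatrix_eigenvectorsNowhereZero {V : Type*}
    [Fintype V] [DecidableEq V] {T : SimpleGraph V} [DecidableRel T.Adj] (hT : T.IsTree) :
    ∃ d : V → ℝ, (Matrix.diagonal d + T.adjMatrix ℝ).EigenvectorsNowhereZero := by
  have := hT.connected.nonempty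
  obtain ⟨d, hd⟩ := exists_forall_exists_forall_ne_le_abs_sub V (Fintype.card V) (by positivity)
  refine ⟨d, fun c v hv ⟨i, hi⟩ => ?_⟩
  obtain ⟨r, hr⟩ := hd c
  refine hT.eq_zero_of_apply_eq_zero (e := fun u => c - d u) hr (fun u => ?_) hi
  have := congrFun hv u
  rw [Matrix.add_mulVec, Pi.add_apply, Matrix.mulVec_diagonal,
    SimpleGraph.adjMatrix_mulVec_apply, Pi.smul_apply, smul_eq_mul] at this
  linarith

/-! ### Perturbation from a spanning tree to the graph -/

/-- Having no eigenvector with a zero entry is stable under small perturbations. -/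
lemma Matrix.EigenvectorsNowhereZero.eventually_add_smul {V : Type*} [Fintype V]
    {M : Matrix V V ℝ} (hM : M.EigenvectorsNowhereZero) (N : Matrix V V ℝ) :
    ∀ᶠ t : ℝ in nhds 0, (M + t • N).EigenvectorsNowhereZero := by
  set K : Set (V → ℝ) := {v | v ⬝ᵥ v = 1} ∩ {v | ∃ i, v i = 0}
  have hKc : IsClosed K := by
    refine (isClosed_eq (by fun_prop) continuous_const).inter ?_
    rw [Set.ofPred_exists]
    exact isClosed_iUnion_of_finite fun i => isClosed_eq (continuous_apply i) continuous_const
  have hK : IsCompact K := by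
    refine (isCompact_univ_pi fun _ : V => isCompact_Icc (a := (-1 : ℝ)) (b := 1)).of_isClosed_subset
      hKc fun v hv i _ => ?_
    have h1 : v i * v i ≤ v ⬝ᵥ v :=
      Finset.single_le_sum (f := fun i => v i * v i) (fun j _ => mul_self_nonneg _)
        (Finset.mem_univ i)
    rw [hv.1] at h1
    exact abs_le.1 ((abs_le_one_iff_mul_self_le_one).2 h1)
  -- On unit vectors, `F` vanishes exactly at eigenvectors. The Rayleigh quotient replaces the
  -- unknown eigenvalue, so compactness of `K` suffices.
  let F : ℝ × (V → ℝ) → V → ℝ := fun z =>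
    (M + z.1 • N) *ᵥ z.2 - (z.2 ⬝ᵥ ((M + z.1 • N) *ᵥ z.2)) • z.2
  have hF : Continuous F := by fun_prop
  have key : ∀ᶠ t : ℝ in nhds 0, ∀ v ∈ K, F (t, v) ≠ 0 := by
    refine hK.eventually_forall_of_forall_eventually (P := fun t v => F (t, v) ≠ 0) fun v hv => ?_
    refine hF.continuousAt.eventually_ne fun h0 => ?_
    have h1 : v = 0 := by
      refine hM (v ⬝ᵥ (M *ᵥ v)) v ?_ hv.2
      simpa [F] using sub_eq_zero.1 h0
    have h2 := hv.1
    simp [h1] at h2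
  filter_upwards [key] with t ht c v hv ⟨i, hi⟩
  by_contra hne
  have hpos : 0 < v ⬝ᵥ v :=
    lt_of_le_of_ne (Finset.sum_nonneg fun j _ => mul_self_nonneg _)
      (fun h => hne (dotProduct_self_eq_zero.1 h.symm))
  set s := (Real.sqrt (v ⬝ᵥ v))⁻¹
  have hs : s * s * (v ⬝ᵥ v) = 1 := by
    rw [← mul_inv, Real.mul_self_sqrt hpos.le, inv_mul_cancel₀ hpos.ne']
  have hunit : (s • v) ⬝ᵥ (s • v) = 1 := by
    rw [smul_dotProduct, dotProduct_smul, smul_eq_mul, smul_eq_mul, ← mul_assoc, hs]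
  refine ht (s • v) ⟨hunit, i, by simp [hi]⟩ ?_
  have hev : (M + t • N) *ᵥ (s • v) = c • (s • v) := by
    rw [Matrix.mulVec_smul, hv, smul_comm]
  simp only [F]
  rw [hev, dotProduct_smul, hunit, smul_eq_mul, mul_one, sub_self]

/-- Every connected graph has a matrix in `𝒮(G)` no eigenvector of which has a zero entry. -/
theorem SimpleGraph.Connected.exists_mem_symmMatrices_eigenvectorsNowhereZero {V : Type*}
    [Fintype V]
    {G : SimpleGraph V} (hG : G.Connected) :
    ∃ M ∈ G.symmMatrices, M.EigenvectorsNowhereZero := by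
  classical
  obtain ⟨T, hTG, hT⟩ := hG.exists_isTree_le
  obtain ⟨d, hd⟩ := hT.exists_diagonal_add_adjMatrix_eigenvectorsNowhereZero
  have h1 := (hd.eventually_add_smul (G.adjMatrix ℝ)).filter_mono
    (nhdsWithin_le_nhds (s := Set.Ioi (0 : ℝ)))
  obtain ⟨t, ht, htpos⟩ := (h1.and self_mem_nhdsWithin).exists
  refine ⟨_, ⟨?_, fun i j hij => ?_⟩, ht⟩
  · exact ((Matrix.isSymm_diagonal d).add T.isSymm_adjMatrix).add (G.isSymm_adjMatrix.smul t)
  · have ht0 : 0 < t := htpos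
    simp only [Matrix.add_apply, Matrix.diagonal_apply_ne _ hij, Matrix.smul_apply,
      SimpleGraph.adjMatrix_apply, smul_eq_mul, zero_add]
    by_cases hg : G.Adj i j
    · simp only [hg, if_true, iff_true, mul_one]
      split_ifs <;> positivity
    · have hgT : ¬ T.Adj i j := fun h => hg (hTG h)
      simp [hg, hgT]

/-! ### The projection representing the join -/

/-- The spectral theorem for real symmetric matrices, in matrix form. -/
lemma Matrix.IsSymm.exists_eq_mul_diagonal_mul_transpose {V : Type*} [Fintype V] [DecidableEq V]
    {A : Matrix V V ℝ} (hA : A.IsSymm) :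
    ∃ (W : Matrix V V ℝ) (e : V → ℝ), Wᵀ * W = 1 ∧ W * Wᵀ = 1 ∧ A = W * diagonal e * Wᵀ ∧
      A.charpoly.roots = Finset.univ.val.map e := by
  have hH : A.IsHermitian := by
    rw [Matrix.IsHermitian, Matrix.conjTranspose_eq_transpose_of_trivial]
    exact hA
  refine ⟨hH.eigenvectorUnitary, hH.eigenvalues, ?_, ?_, ?_, ?_⟩
  · have := Unitary.coe_star_mul_self hH.eigenvectorUnitary
    rwa [Matrix.star_eq_conjTranspose, Matrix.conjTranspose_eq_transpose_of_trivial] at this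
  · have := Unitary.coe_mul_star_self hH.eigenvectorUnitary
    rwa [Unitary.coe_star, Matrix.star_eq_conjTranspose,
      Matrix.conjTranspose_eq_transpose_of_trivial] at this
  · have := hH.spectral_theorem
    rw [Unitary.conjStarAlgAut_apply, Matrix.star_eq_conjTranspose,
      Matrix.conjTranspose_eq_transpose_of_trivial] at this
    exact this
  · exact hH.roots_charpoly_eq_eigenvalues

/-- A connected graph is represented by the Gram matrix of the rows of a nowhere zero square matrix
with orthogonal columns of norm less than one. -/
theorem SimpleGraph.Connected.exists_mul_transpose_mem_symmMatrices {V : Type*} [Fintype V]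
    [DecidableEq V] {G : SimpleGraph V} (hG : G.Connected) :
    ∃ (U : Matrix V V ℝ) (μ : V → ℝ), (∀ k, μ k < 1) ∧ (∀ i k, U i k ≠ 0) ∧
      Uᵀ * U = Matrix.diagonal μ ∧ U * Uᵀ ∈ G.symmMatrices := by
  obtain ⟨M, ⟨hMs, hMG⟩, hM⟩ := hG.exists_mem_symmMatrices_eigenvectorsNowhereZero
  obtain ⟨W, e, hW, hW', hMW, -⟩ := hMs.exists_eq_mul_diagonal_mul_transpose
  obtain ⟨L, hL⟩ := (Set.finite_range fun k => |e k|).bddAbove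
  replace hL : ∀ k, |e k| ≤ L := fun k => hL ⟨k, rfl⟩
  have hL0 : 0 ≤ L := (abs_nonneg _).trans (hL hG.nonempty.some)
  -- This affine map sends `[-L, L]` into the open interval `(0, 1)`.
  set μ : V → ℝ := fun k => (e k + (L + 1)) * (2 * L + 2)⁻¹ with hμ
  have hμ0 : ∀ k, 0 < μ k := fun k => by
    have := (abs_le.1 (hL k)).1
    exact mul_pos (by linarith) (by positivity)
  have hs : ∀ k, Real.sqrt (μ k) * Real.sqrt (μ k) = μ k := fun k =>
    Real.mul_self_sqrt (hμ0 k).le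
  have hWnz : ∀ i k, W i k ≠ 0 := by
    intro i k h0
    have h1 : M *ᵥ (fun j => W j k) = e k • fun j => W j k := by
      have h2 : M * W = W * Matrix.diagonal e := by
        rw [hMW, Matrix.mul_assoc, hW, Matrix.mul_one]
      ext j
      have := congrFun (congrFun h2 j) k
      rw [Matrix.mul_diagonal, mul_comm] at this
      exact this
    have h2 := hM _ _ h1 ⟨i, h0⟩
    have h3 := congrFun (congrFun hW k) k
    rw [Matrix.mul_apply, Matrix.one_apply_eq, Finset.sum_eq_zero] at h3
    · exact zero_ne_one h3
    · intro j _
      rw [Matrix.transpose_apply, congrFun h2 j, Pi.zero_apply, zero_mul]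
  have hdd : Matrix.diagonal (fun k => Real.sqrt (μ k)) * Matrix.diagonal (fun k => Real.sqrt (μ k))
      = Matrix.diagonal μ := by
    rw [Matrix.diagonal_mul_diagonal]
    exact congrArg _ (funext hs)
  have hUU : (W * Matrix.diagonal (fun k => Real.sqrt (μ k))) *
      (W * Matrix.diagonal (fun k => Real.sqrt (μ k)))ᵀ
      = (2 * L + 2)⁻¹ • (M + (L + 1) • (1 : Matrix V V ℝ)) := by
    have h1 : Matrix.diagonal μ = (2 * L + 2)⁻¹ • (Matrix.diagonal e + (L + 1) • 1) := by
      ext i j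
      by_cases hij : i = j
      · subst hij
        simp [hμ, mul_comm]
      · simp [hij]
    rw [Matrix.transpose_mul, Matrix.diagonal_transpose, Matrix.mul_assoc,
      ← Matrix.mul_assoc (Matrix.diagonal _) (Matrix.diagonal _), hdd, h1, hMW]
    simp [Matrix.mul_add, Matrix.add_mul, ← Matrix.mul_assoc, hW']
  refine ⟨W * Matrix.diagonal fun k => Real.sqrt (μ k), μ, fun k => ?_, fun i k => ?_, ?_, ?_, ?_⟩
  · have := (abs_le.1 (hL k)).2
    simp only [hμ]
    rw [← div_eq_mul_inv, div_lt_one (by positivity)]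
    linarith
  · rw [Matrix.mul_diagonal]
    exact mul_ne_zero (hWnz i k) (Real.sqrt_pos.2 (hμ0 k)).ne'
  · rw [Matrix.transpose_mul, Matrix.diagonal_transpose, Matrix.mul_assoc,
      ← Matrix.mul_assoc Wᵀ, hW, Matrix.one_mul, hdd]
  · exact Matrix.isSymm_mul_transpose_self _
  · intro i j hij
    have : (2 * L + 2)⁻¹ ≠ 0 := by positivity
    rw [hUU, ← hMG i j hij]
    simp [hij, this]

/-- The join with an edgeless graph on equally many vertices is represented by an orthogonal
projection onto a space of half the dimension. -/
theorem SimpleGraph.Connected.exists_mem_symmMatrices_join_charpoly {V ι : Type*} [Fintype V]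
    [DecidableEq V] [Fintype ι] [DecidableEq ι] {G : SimpleGraph V} (hG : G.Connected)
    (f : V ≃ ι) :
    ∃ A ∈ (G.join (⊤ : SimpleGraph ι)ᶜ).symmMatrices,
      A.charpoly = Polynomial.X ^ Fintype.card V * (Polynomial.X - 1) ^ Fintype.card V := by
  obtain ⟨U, μ, hμ, hU, hUU, hUs, hUG⟩ := hG.exists_mul_transpose_mem_symmMatrices
  set D : Matrix V V ℝ := Matrix.diagonal fun k => Real.sqrt (1 - μ k) with hD
  have hs : ∀ k, 0 < Real.sqrt (1 - μ k) := fun k => Real.sqrt_pos.2 (sub_pos.2 (hμ k))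
  have hDD : D * D = Matrix.diagonal fun k => 1 - μ k := by
    rw [hD, Matrix.diagonal_mul_diagonal]
    exact congrArg _ (funext fun k => Real.mul_self_sqrt (sub_pos.2 (hμ k)).le)
  -- The lower block completes the squared column norms `μ k` of `U` to `1`.
  set D' : Matrix ι V ℝ := D.submatrix f.symm id with hD'
  have hDD' : D'ᵀ * D' = D * D := by
    rw [hD', Matrix.transpose_submatrix, Matrix.submatrix_mul_equiv, hD, Matrix.diagonal_transpose,
      Matrix.submatrix_id_id]
  set Z : Matrix (V ⊕ ι) V ℝ := Matrix.fromRows U D' with hZ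
  have hZZ : Zᵀ * Z = 1 := by
    rw [hZ, Matrix.transpose_fromRows, Matrix.fromCols_mul_fromRows, hUU, hDD', hDD,
      Matrix.diagonal_add]
    simp
  have hA : Z * Zᵀ = Matrix.fromBlocks (U * Uᵀ) (U * D'ᵀ) (D' * Uᵀ) (D' * D'ᵀ) := by
    rw [hZ, Matrix.transpose_fromRows, Matrix.fromRows_mul_fromCols]
  have hent : ∀ a i, D' i a = if f.symm i = a then Real.sqrt (1 - μ a) else 0 := by
    intro a i
    rw [hD', Matrix.submatrix_apply, hD, Matrix.diagonal_apply, id]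
    split_ifs with h
    · rw [h]
    · rfl
  have hUD : ∀ a i, (U * D'ᵀ) a i = U a (f.symm i) * Real.sqrt (1 - μ (f.symm i)) := by
    intro a i
    rw [Matrix.mul_apply]
    simp [hent]
  have hDU : ∀ a i, (D' * Uᵀ) i a = U a (f.symm i) * Real.sqrt (1 - μ (f.symm i)) := by
    intro a i
    rw [← hUD, ← Matrix.transpose_apply (D' * Uᵀ), Matrix.transpose_mul, Matrix.transpose_transpose]
  refine ⟨Z * Zᵀ, ⟨?_, ?_⟩, ?_⟩
  · rw [Matrix.IsSymm, Matrix.transpose_mul, Matrix.transpose_transpose]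
  · rw [hA]
    rintro (a | i) (b | j) hne
    · simpa [SimpleGraph.join] using hUG a b (by simpa using hne)
    · simpa [SimpleGraph.join, hUD] using ⟨hU _ _, (hs _).ne'⟩
    · simpa [SimpleGraph.join, hDU] using ⟨hU _ _, (hs _).ne'⟩
    · have hij : i ≠ j := by simpa using hne
      have : (D' * D'ᵀ) i j = 0 := by
        rw [Matrix.mul_apply]
        refine Finset.sum_eq_zero fun k _ => ?_
        rw [Matrix.transpose_apply, hent, hent]
        split_ifs with h1 h2
        · exact absurd (f.symm.injective (h1.trans h2.symm)) hij
        all_goals simp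
      simp [SimpleGraph.join, this]
  -- `Z * Zᵀ` and `Zᵀ * Z = 1` have the same characteristic polynomial up to a power of `X`.
  · rw [Matrix.charpoly_mul_comm_of_le _ _ (by simp), hZZ, Matrix.charpoly_one, Fintype.card_sum,
      Nat.add_sub_cancel_left, Fintype.card_congr f]

/-! ### Lower bounds from independent sets -/

/-- If a symmetric matrix represents a graph without isolated vertices and has at most two
eigenvalues `a` and `b`, then the eigenvalues other than `a` are at least as many as the vertices of
any independent set. -/
theorem SimpleGraph.card_le_card_ne_of_independent {V ι : Type*} [Fintype V] [DecidableEq V]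
    [Fintype ι] {G : SimpleGraph V} {A W : Matrix V V ℝ} {e : V → ℝ} {a b : ℝ}
    (hA : A ∈ G.symmMatrices) (hW : Wᵀ * W = 1) (hW' : W * Wᵀ = 1)
    (hAW : A = W * Matrix.diagonal e * Wᵀ) (he : ∀ i, e i = a ∨ e i = b) (g : ι ↪ V)
    (hg : ∀ i j, ¬ G.Adj (g i) (g j)) (hdeg : ∀ i, ∃ v, G.Adj (g i) v) :
    Fintype.card ι ≤ (Finset.univ.filter fun i => e i ≠ a).card := by
  classical
  set B : Matrix V V ℝ := W * Matrix.diagonal (fun i => e i - a) * Wᵀ with hB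
  have hBA : A = B + a • (1 : Matrix V V ℝ) := by
    have : Matrix.diagonal e = Matrix.diagonal (fun i => e i - a) + a • (1 : Matrix V V ℝ) := by
      ext i j
      by_cases hij : i = j
      · subst hij
        simp
      · simp [hij]
    rw [hAW, this, Matrix.mul_add, Matrix.add_mul, Matrix.mul_smul, Matrix.smul_mul, Matrix.mul_one,
      hW']
  have hoff : ∀ i j, i ≠ j → B i j = A i j := fun i j hij => by simp [hBA, hij]
  have hBs : ∀ i j, B i j = B j i := by
    intro i j
    by_cases hij : i = j
    · rw [hij]
    · rw [hoff _ _ hij, hoff _ _ (Ne.symm hij)]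
      exact (hA.1.apply i j).symm
  have hBB : B * B = (b - a) • B := by
    have h1 : Matrix.diagonal (fun i => e i - a) * Matrix.diagonal (fun i => e i - a)
        = (b - a) • Matrix.diagonal (fun i => e i - a) := by
      rw [Matrix.diagonal_mul_diagonal, ← Matrix.diagonal_smul]
      refine congrArg _ (funext fun i => ?_)
      rcases he i with h | h <;> simp [h]
    calc B * B = W * (Matrix.diagonal (fun i => e i - a) * (Wᵀ * W) *
          Matrix.diagonal (fun i => e i - a)) * Wᵀ := by simp only [hB, Matrix.mul_assoc]
      _ = _ := by rw [hW, Matrix.mul_one, h1, Matrix.mul_smul, Matrix.smul_mul]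
  -- A diagonal entry of `B * B` is the squared norm of a row, so a zero here would kill the row and
  -- isolate the vertex.
  have hdiag : ∀ i, B (g i) (g i) ≠ 0 := by
    intro i h0
    have h1 := congrFun (congrFun hBB (g i)) (g i)
    rw [Matrix.smul_apply, h0, smul_zero, Matrix.mul_apply] at h1
    obtain ⟨v, hv⟩ := hdeg i
    have h2 := (Finset.sum_eq_zero_iff_of_nonneg fun j _ => by
      rw [hBs j]; exact mul_self_nonneg _).1 h1 v (Finset.mem_univ _)
    rw [hBs v, mul_self_eq_zero, hoff _ _ hv.ne] at h2
    exact (hA.2 _ _ hv.ne).2 hv h2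
  have hsub : B.submatrix g g = Matrix.diagonal fun i => B (g i) (g i) := by
    ext i j
    by_cases hij : i = j
    · subst hij
      simp
    · have hne := g.injective.ne hij
      rw [Matrix.diagonal_apply_ne _ hij, Matrix.submatrix_apply, hoff _ _ hne]
      by_contra h
      exact hg i j ((hA.2 _ _ hne).1 h)
  calc Fintype.card ι = (B.submatrix g g).rank := by
        rw [hsub, Matrix.rank_diagonal]
        exact (Fintype.card_congr (Equiv.subtypeUnivEquiv hdiag)).symm
    _ ≤ B.rank := Matrix.rank_submatrix_le _ _ _
    _ ≤ (Matrix.diagonal fun i => e i - a).rank :=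
        (Matrix.rank_mul_le_left _ _).trans (Matrix.rank_mul_le_right _ _)
    _ = _ := by
        rw [Matrix.rank_diagonal, Fintype.card_subtype]
        simp only [ne_eq, sub_eq_zero]

lemma SimpleGraph.join_compl_top_not_adj_inr {V ι : Type*} (G : SimpleGraph V) (i j : ι) :
    ¬ (G.join (⊤ : SimpleGraph ι)ᶜ).Adj (Sum.inr i) (Sum.inr j) := by
  simp [SimpleGraph.join]

lemma SimpleGraph.join_adj_inr_inl {V ι : Type*} (G : SimpleGraph V) (H : SimpleGraph ι) (i : ι)
    (v : V) : (G.join H).Adj (Sum.inr i) (Sum.inl v) := by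
  simp [SimpleGraph.join]

lemma Matrix.spectrum_eq_toFinset_roots_charpoly {V : Type*} [Fintype V] [DecidableEq V]
    (A : Matrix V V ℝ) : spectrum ℝ A = A.charpoly.roots.toFinset := by
  ext x
  simp [Matrix.mem_spectrum_iff_isRoot_charpoly, A.charpoly_monic.ne_zero]

/-- A graph with an edge has no matrix with fewer than two distinct eigenvalues. -/
lemma SimpleGraph.two_le_numDistinctEigenvalues {V : Type*} [Fintype V] [DecidableEq V]
    {G : SimpleGraph V} {A : Matrix V V ℝ} (hA : A ∈ G.symmMatrices) {u v : V} (huv : G.Adj u v) :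
    2 ≤ A.numDistinctEigenvalues := by
  obtain ⟨W, e, hW, hW', hAW, hroots⟩ := hA.1.exists_eq_mul_diagonal_mul_transpose
  by_contra hlt
  rw [Matrix.numDistinctEigenvalues, A.spectrum_eq_toFinset_roots_charpoly,
    Set.ncard_coe_finset, hroots, not_le, Nat.lt_succ_iff, Finset.card_le_one] at hlt
  have h1 : ∀ i, e i = e u := fun i => hlt _ (by simp) _ (by simp)
  -- A single vertex is the independent set, and `a = b` is the only eigenvalue.
  have h2 := SimpleGraph.card_le_card_ne_of_independent hA hW hW' hAW (a := e u) (b := e u)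
    (fun i => Or.inl (h1 i)) (⟨fun _ : Unit => u, fun _ _ _ => rfl⟩) (by simp)
    (fun _ => ⟨v, huv⟩)
  simp [h1] at h2

theorem lemma3p12 {V : Type*} [Fintype V] [DecidableEq V] (G : SimpleGraph V) (n : ℕ)
    (hn : 2 ≤ n) (hV : Fintype.card V = n) (hG : G.Connected) :
    (G.join ((⊤ : SimpleGraph (Fin n))ᶜ)).minDistinctEigenvalues = 2 ∧
      (G.join ((⊤ : SimpleGraph (Fin n))ᶜ)).minMultiplicityBipartition = n := by
  obtain ⟨A, hA, hchar⟩ := hG.exists_mem_symmMatrices_join_charpoly (Fintype.equivFinOfCardEq hV)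
  have v0 := hG.nonempty.some
  have hadj : ∀ i : Fin n, (G.join ((⊤ : SimpleGraph (Fin n))ᶜ)).Adj (Sum.inr i) (Sum.inl v0) :=
    fun i => G.join_adj_inr_inl _ i v0
  have hroots : A.charpoly.roots = n • {0} + n • {1} := by
    rw [hchar, hV, Polynomial.roots_mul (mul_ne_zero (by simp) (pow_ne_zero _
      (by simpa using Polynomial.X_sub_C_ne_zero (1 : ℝ)))), Polynomial.roots_X_pow,
      Polynomial.roots_pow, ← Polynomial.C_1, Polynomial.roots_X_sub_C]
  have hn0 : n ≠ 0 := by omega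
  have hdedup : A.charpoly.roots.toFinset = {0, 1} := by
    ext x
    simp [hroots, hn0]
  have hcard : Fintype.card (V ⊕ Fin n) = 2 * n := by
    rw [Fintype.card_sum, hV, Fintype.card_fin, two_mul]
  constructor
  · refine le_antisymm (Nat.sInf_le ⟨A, hA, ?_⟩) ?_
    · rw [Matrix.numDistinctEigenvalues, A.spectrum_eq_toFinset_roots_charpoly,
        Set.ncard_coe_finset, hdedup]
      simp
    · refine le_csInf ⟨_, A, hA, rfl⟩ ?_
      rintro _ ⟨A', hA', rfl⟩
      exact SimpleGraph.two_le_numDistinctEigenvalues hA' (hadj ⟨0, by omega⟩)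
  · have hmem : n ∈ {k | k ≤ Fintype.card (V ⊕ Fin n) / 2 ∧
        (G.join ((⊤ : SimpleGraph (Fin n))ᶜ)).AchievesMultiplicityPartition
          {Fintype.card (V ⊕ Fin n) - k, k}} := by
      refine ⟨by omega, A, hA, ?_⟩
      have h1 : A.charpoly.roots.dedup = {0, 1} := by
        have := congrArg Finset.val hdedup
        simpa using this
      rw [Matrix.eigenvalueMultiplicities, h1, hcard, hroots]
      simp [Multiset.count_nsmul, show 2 * n - n = n by omega]
    refine le_antisymm (Nat.sInf_le hmem) (le_csInf ⟨n, hmem⟩ ?_)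
    rintro k ⟨hk, A', hA', hmult⟩
    obtain ⟨W, e, hW, hW', hAW, hr⟩ := hA'.1.exists_eq_mul_diagonal_mul_transpose
    rw [Matrix.eigenvalueMultiplicities] at hmult
    -- Choosing `a` of multiplicity `2 * n - k` leaves `k` eigenvalues different from `a`, counted
    -- with multiplicity.
    obtain ⟨a, ha, hcount⟩ := Multiset.mem_map.1
      (hmult.symm ▸ Multiset.mem_cons_self _ _ :
        Fintype.card (V ⊕ Fin n) - k ∈
          A'.charpoly.roots.dedup.map fun x => A'.charpoly.roots.count x)
    obtain ⟨b, hb⟩ : ∃ b, ∀ x ∈ A'.charpoly.roots.dedup, x = a ∨ x = b := by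
      have h2 := congrArg Multiset.card hmult
      rw [Multiset.card_map, Multiset.card_pair, Multiset.card_eq_two] at h2
      obtain ⟨x, y, hxy⟩ := h2
      rw [hxy] at ha ⊢
      simp only [Multiset.insert_eq_cons, Multiset.mem_cons, Multiset.mem_singleton] at ha ⊢
      rcases ha with rfl | rfl
      · exact ⟨y, fun _ h => h⟩
      · exact ⟨x, fun _ h => h.symm⟩
    have h3 := SimpleGraph.card_le_card_ne_of_independent hA' hW hW' hAW (a := a) (b := b)
      (fun i => hb _ (by simp [hr])) (Function.Embedding.inr : Fin n ↪ V ⊕ Fin n)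
      (fun i j => G.join_compl_top_not_adj_inr i j) (fun i => ⟨_, hadj i⟩)
    have h4 : (Finset.univ.filter fun i => e i = a).card = 2 * n - k := by
      rw [← hcard, ← hcount, hr, Multiset.count_map, Finset.card_def, Finset.filter_val]
      simp only [eq_comm]
    have h5 := Finset.card_filter_add_card_filter_not (s := (Finset.univ : Finset (V ⊕ Fin n)))
      (fun i => e i = a)
    rw [h4, Finset.card_univ, hcard] at h5
    rw [Fintype.card_fin] at h3
    simp only [ne_eq] at h3
    omega
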